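/- **Relative Hurewicz Theorem in dimension 1.** Let $X$ be a topological space and let $A\subseteq X$ be a subspace which is totally path-disconnected (no two distinct points of $A$ are joined by a path in $A$; for example, $A$ discrete) and which meets every path component of $X$. Let $\pi_1(X,A)$ be the fundamental groupoid of $X$ on the set $A$ of base points: its objects are the points of $A$, and its arrows $a\to b$ are the homotopy classes rel end points of paths in $X$ from $a$ to $b$. For a groupoid $G$ let $\upsilon\colon G\to G^{\mathrm{totab}}$ be its universal ("total") abelianisation, i.e. the universal morphism from $G$ to an abelian group; explicitly, $G^{\mathrm{totab}}$ is the abelian group generated by the arrows of $G$ with the relations $[fg]=[f]+[g]$ for all composable $f,g$. Let $H_1(X,A)$ be the first relative singular homology group with integer coefficients, computed from the chain complex $C_*(X)/C_*(A)$, where $C_*$ denotes normalised cubical singular chains (the free abelian groups on the singular cubes modulo the degenerate ones, with boundary $\partial k=\sum_{i=1}^{n}(-1)^i(\partial_i^-k-\partial_i^+k)$ for a singular $n$-cube $k$, where $\partial_i^{-}k$ and $\partial_i^{+}k$ are the faces of $k$ on which the $i$-th coordinate is $0$ and $1$). Then sending the class of a path $p\colon[0,1]\to X$ with end points in $A$ to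 the homology class of $p$, regarded as a singular $1$-cube, is a well-defined morphism $\pi_1(X,A)\to H_1(X,A)$, and the induced natural morphism $$\pi_1(X,A)^{\mathrm{totab}}\longrightarrow H_1(X,A)$$ is an isomorphism. -/

import Mathlib

open CategoryTheory
open scoped unitInterval

noncomputable section

namespace RelHurewicz

universe u v w

/-! ## The total (universal) abelianisation of a groupoid -/

section Totab

variable (G : Type u) [Groupoid.{v} G]

/-- The relations `[f ≫ g] = [f] + [g]` between the arrows of a groupoid. -/
def totabRelations : Set (FreeAbelianGroup (Σ a b : G, (a ⟶ b))) :=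
  {x | ∃ (a b c : G) (f : a ⟶ b) (g : b ⟶ c),
    x = FreeAbelianGroup.of ⟨a, c, f ≫ g⟩
      - (FreeAbelianGroup.of ⟨a, b, f⟩ + FreeAbelianGroup.of ⟨b, c, g⟩)}

/-- The universal abelianisation of a groupoid `G`: the abelian group generated by the arrows
of `G`, subject to the relations `[f ≫ g] = [f] + [g]`. -/
abbrev Totab : Type (max u v) :=
  FreeAbelianGroup (Σ a b : G, (a ⟶ b)) ⧸ AddSubgroup.closure (totabRelations G)

variable {G}

/-- The universal morphism from a groupoid to its universal abelianisation. -/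
def toTotab {a b : G} (f : a ⟶ b) : Totab G :=
  QuotientAddGroup.mk (FreeAbelianGroup.of ⟨a, b, f⟩)

theorem toTotab_comp {a b c : G} (f : a ⟶ b) (g : b ⟶ c) :
    toTotab (f ≫ g) = toTotab f + toTotab g := by
  have h : (QuotientAddGroup.mk (FreeAbelianGroup.of ⟨a, c, f ≫ g⟩
      - (FreeAbelianGroup.of ⟨a, b, f⟩ + FreeAbelianGroup.of ⟨b, c, g⟩)) : Totab G) = 0 :=
    (QuotientAddGroup.eq_zero_iff _).2 (AddSubgroup.subset_closure ⟨a, b, c, f, g, rfl⟩)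
  rw [QuotientAddGroup.mk_sub, QuotientAddGroup.mk_add, sub_eq_zero] at h
  exact h

/-- The additive map induced on the universal abelianisation by a morphism `φ` from a groupoid
to an abelian group (that is, a functor to the one-object groupoid of that group). -/
def totabLift {M : Type w} [AddCommGroup M] (φ : ∀ a b : G, (a ⟶ b) → M)
    (hφ : ∀ (a b c : G) (f : a ⟶ b) (g : b ⟶ c), φ a c (f ≫ g) = φ a b f + φ b c g) :
    Totab G →+ M :=
  QuotientAddGroup.lift _ (FreeAbelianGroup.lift fun x => φ x.1 x.2.1 x.2.2) (by
    rw [AddSubgroup.closure_le]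
    rintro x ⟨a, b, c, f, g, rfl⟩
    simp [AddMonoidHom.mem_ker, hφ])

@[simp]
theorem totabLift_toTotab {M : Type w} [AddCommGroup M] (φ : ∀ a b : G, (a ⟶ b) → M)
    (hφ : ∀ (a b c : G) (f : a ⟶ b) (g : b ⟶ c), φ a c (f ≫ g) = φ a b f + φ b c g)
    {a b : G} (f : a ⟶ b) : totabLift φ hφ (toTotab f) = φ a b f := by
  simp [totabLift, toTotab]

/-- Additive maps out of the universal abelianisation are determined by their values on arrows;
with `totabLift_toTotab` this is the universal property. -/
theorem totab_hom_ext {M : Type w} [AddCommGroup M] {α β : Totab G →+ M}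
    (h : ∀ (a b : G) (f : a ⟶ b), α (toTotab f) = β (toTotab f)) : α = β := by
  apply QuotientAddGroup.addMonoidHom_ext
  apply FreeAbelianGroup.lift_ext
  rintro ⟨a, b, f⟩
  exact h a b f

end Totab

/-! ## Cubical singular chains -/

section Chains

variable {X : Type u} [TopologicalSpace X] {Y : Type v} [TopologicalSpace Y]

/-- Singular `n`-cubes of a space. -/
abbrev SingularCube (X : Type u) [TopologicalSpace X] (n : ℕ) : Type u := C(Fin n → I, X)

/-- The face of a singular cube on which the `i`-th coordinate is `e` (used for `e = 0, 1`). -/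
def face {n : ℕ} (i : Fin (n + 1)) (e : I) (k : SingularCube X (n + 1)) : SingularCube X n where
  toFun t := k (i.insertNth e t)
  continuous_toFun := k.continuous.comp (continuous_const.finInsertNth i continuous_id)

/-- A singular cube is degenerate if it does not depend on one of its coordinates. -/
def IsDegenerate {n : ℕ} (k : SingularCube X n) : Prop :=
  ∃ i : Fin n, ∀ s t : Fin n → I, (∀ j, j ≠ i → s j = t j) → k s = k t

/-- The subgroup generated by the degenerate cubes. -/
def degenerateChains (X : Type u) [TopologicalSpace X] (n : ℕ) :
    AddSubgroup (FreeAbelianGroup (SingularCube X n)) :=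
  AddSubgroup.closure {x | ∃ k : SingularCube X n, IsDegenerate k ∧ x = FreeAbelianGroup.of k}

/-- The normalised cubical singular chains `C_n(X)`. -/
abbrev Chains (X : Type u) [TopologicalSpace X] (n : ℕ) : Type u :=
  FreeAbelianGroup (SingularCube X n) ⧸ degenerateChains X n

/-- The boundary of unnormalised cubical chains,
`∂ k = ∑_{i = 1}^{n + 1} (-1) ^ i (∂⁻ᵢ k - ∂⁺ᵢ k)`; the index `i : Fin (n + 1)` of
the code starts from `0`. -/
def freeBoundary (X : Type u) [TopologicalSpace X] (n : ℕ) :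
    FreeAbelianGroup (SingularCube X (n + 1)) →+ FreeAbelianGroup (SingularCube X n) :=
  FreeAbelianGroup.lift fun k => ∑ i : Fin (n + 1),
    (-1 : ℤ) ^ ((i : ℕ) + 1) •
      (FreeAbelianGroup.of (face i 0 k) - FreeAbelianGroup.of (face i 1 k))

theorem freeBoundary_of {n : ℕ} (k : SingularCube X (n + 1)) :
    freeBoundary X n (FreeAbelianGroup.of k) = ∑ i : Fin (n + 1),
      (-1 : ℤ) ^ ((i : ℕ) + 1) •
        (FreeAbelianGroup.of (face i 0 k) - FreeAbelianGroup.of (face i 1 k)) := by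
  simp [freeBoundary]

theorem freeBoundary_degenerate (n : ℕ) :
    degenerateChains X (n + 1) ≤ (degenerateChains X n).comap (freeBoundary X n) := by
  rw [degenerateChains, AddSubgroup.closure_le]
  rintro _ ⟨k, ⟨i, hi⟩, rfl⟩
  show freeBoundary X n (FreeAbelianGroup.of k) ∈ degenerateChains X n
  rw [freeBoundary_of]
  refine AddSubgroup.sum_mem _ fun j _ => AddSubgroup.zsmul_mem _ ?_ _
  by_cases hj : j = i
  · subst hj
    have : face j 0 k = face j 1 k := by
      ext t
      refine hi _ _ fun l hl => ?_
      obtain ⟨l, rfl⟩ := Fin.exists_succAbove_eq hl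
      simp
    rw [this, sub_self]
    exact AddSubgroup.zero_mem _
  · have hdeg : ∀ e : I, FreeAbelianGroup.of (face j e k) ∈ degenerateChains X n := by
      intro e
      obtain ⟨i', rfl⟩ := Fin.exists_succAbove_eq (Ne.symm hj)
      refine AddSubgroup.subset_closure ⟨_, ⟨i', fun s t hst => ?_⟩, rfl⟩
      refine hi _ _ fun l hl => ?_
      rcases eq_or_ne l j with rfl | hlj
      · simp
      · obtain ⟨l, rfl⟩ := Fin.exists_succAbove_eq hlj
        have : l ≠ i' := fun h => hl (by rw [h])
        simpa using hst l this
    exact AddSubgroup.sub_mem _ (hdeg 0) (hdeg 1)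

/-- The boundary `C_{n+1}(X) → C_n(X)` of normalised cubical chains. -/
def boundary (X : Type u) [TopologicalSpace X] (n : ℕ) : Chains X (n + 1) →+ Chains X n :=
  QuotientAddGroup.map _ _ (freeBoundary X n) (freeBoundary_degenerate n)

/-- The map `C_n(Y) → C_n(X)` induced by a continuous map `f : Y → X`. -/
def chainsMap (f : C(Y, X)) (n : ℕ) : Chains Y n →+ Chains X n :=
  QuotientAddGroup.map _ _ (FreeAbelianGroup.map fun k : SingularCube Y n => f.comp k) (by
    rw [degenerateChains, AddSubgroup.closure_le]
    rintro _ ⟨k, ⟨i, hi⟩, rfl⟩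
    refine AddSubgroup.subset_closure ⟨f.comp k, ⟨i, fun s t hst => ?_⟩, ?_⟩
    · exact congrArg f (hi s t hst)
    · simp)

theorem boundary_chainsMap (f : C(Y, X)) (n : ℕ) (c : Chains Y (n + 1)) :
    boundary X n (chainsMap f (n + 1) c) = chainsMap f n (boundary Y n c) := by
  suffices h : (boundary X n).comp (chainsMap f (n + 1)) = (chainsMap f n).comp (boundary Y n) from
    DFunLike.congr_fun h c
  apply QuotientAddGroup.addMonoidHom_ext
  apply FreeAbelianGroup.lift_ext
  intro k
  have hface : ∀ (i : Fin (n + 1)) (e : I), face i e (f.comp k) = f.comp (face i e k) :=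
    fun _ _ => rfl
  simp [boundary, chainsMap, freeBoundary_of, hface]

theorem face_face {n : ℕ} (i : Fin (n + 2)) (j : Fin (n + 1)) (d e : I)
    (k : SingularCube X (n + 2)) :
    face (j.predAbove i) d (face (i.succAbove j) e k) = face j e (face i d k) := by
  ext t
  refine congrArg k (funext fun l => ?_)
  rcases eq_or_ne l i with rfl | hl
  · refine (congrArg (Fin.insertNth (α := fun _ => I) (l.succAbove j) e
      ((j.predAbove l).insertNth d t)) (Fin.succAbove_succAbove_predAbove l j).symm).trans ?_
    rw [Fin.insertNth_apply_succAbove, Fin.insertNth_apply_same, Fin.insertNth_apply_same]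
  · obtain ⟨l, rfl⟩ := Fin.exists_succAbove_eq hl
    rcases eq_or_ne l j with rfl | hlj
    · rw [Fin.insertNth_apply_same, Fin.insertNth_apply_succAbove, Fin.insertNth_apply_same]
    · obtain ⟨l, rfl⟩ := Fin.exists_succAbove_eq hlj
      refine (congrArg (Fin.insertNth (α := fun _ => I) (i.succAbove j) e
        ((j.predAbove i).insertNth d t))
        (Fin.succAbove_succAbove_succAbove_predAbove i j l).symm).trans ?_
      simp only [Fin.insertNth_apply_succAbove]

theorem freeBoundary_freeBoundary {n : ℕ} (c : FreeAbelianGroup (SingularCube X (n + 2))) :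
    freeBoundary X n (freeBoundary X (n + 1) c) = 0 := by
  suffices h : (freeBoundary X n).comp (freeBoundary X (n + 1)) = 0 from DFunLike.congr_fun h c
  apply FreeAbelianGroup.lift_ext
  intro k
  simp only [AddMonoidHom.comp_apply, freeBoundary_of, map_sum, map_zsmul, map_sub,
    AddMonoidHom.zero_apply, Finset.smul_sum, ← Finset.sum_sub_distrib, ← smul_sub, smul_smul,
    ← pow_add]
  rw [← Finset.sum_product']
  refine Finset.sum_involution (fun p _ => (p.1.succAbove p.2, p.2.predAbove p.1)) ?_ ?_ ?_ ?_
  · rintro ⟨i, j⟩ -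
    have hsign : (-1 : ℤ) ^ ((i.succAbove j : ℕ) + 1 + ((j.predAbove i : ℕ) + 1))
        = - (-1 : ℤ) ^ ((i : ℕ) + 1 + ((j : ℕ) + 1)) := by
      rcases lt_or_ge j.castSucc i with h | h
      · rw [Fin.succAbove_of_castSucc_lt _ _ h, Fin.predAbove_of_castSucc_lt _ _ h]
        have h' : (j : ℕ) < i := h
        have : (i : ℕ) + 1 + ((j : ℕ) + 1) = ((j : ℕ) + 1 + ((i : ℕ) - 1 + 1)) + 1 := by omega
        simp only [Fin.val_castSucc, Fin.val_pred]
        rw [this, pow_succ]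
        ring
      · rw [Fin.succAbove_of_le_castSucc _ _ h, Fin.predAbove_of_le_castSucc _ _ h]
        simp only [Fin.val_succ, Fin.coe_castPred]
        ring
    simp only [face_face, hsign, neg_smul]
    rw [← sub_eq_add_neg, ← smul_sub]
    convert smul_zero _ using 2
    abel
  · rintro ⟨i, j⟩ - - h
    exact Fin.succAbove_ne i j (congrArg Prod.fst h)
  · simp
  · rintro ⟨i, j⟩ -
    have h1 := Fin.succAbove_succAbove_predAbove i j
    refine Prod.ext h1 ?_
    apply Fin.succAbove_right_injective (p := i)
    have h2 := Fin.succAbove_succAbove_predAbove (i.succAbove j) (j.predAbove i)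
    simp only [h1] at h2
    exact h2

theorem boundary_boundary {n : ℕ} (c : Chains X (n + 2)) :
    boundary X n (boundary X (n + 1) c) = 0 := by
  obtain ⟨c, rfl⟩ := QuotientAddGroup.mk_surjective c
  simp [boundary, freeBoundary_freeBoundary]

end Chains

/-! ## Relative homology -/

section Relative

variable {X : Type u} [TopologicalSpace X] (A : Set X)

/-- The inclusion of a subspace. -/
def incl : C(A, X) := ⟨Subtype.val, continuous_subtype_val⟩

/-- The relative chains `C_n(X, A) = C_n(X) / C_n(A)`. -/
abbrev RelChains (n : ℕ) : Type u := Chains X n ⧸ (chainsMap (incl A) n).range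

/-- The boundary `C_{n+1}(X, A) → C_n(X, A)`. -/
def relBoundary (n : ℕ) : RelChains A (n + 1) →+ RelChains A n :=
  QuotientAddGroup.map _ _ (boundary X n) (by
    rintro _ ⟨c, rfl⟩
    exact ⟨boundary A n c, (boundary_chainsMap (incl A) n c).symm⟩)

theorem relBoundary_relBoundary {n : ℕ} (c : RelChains A (n + 2)) :
    relBoundary A n (relBoundary A (n + 1) c) = 0 := by
  obtain ⟨c, rfl⟩ := QuotientAddGroup.mk_surjective c
  simp [relBoundary, boundary_boundary]

/-- Relative `n`-cycles. -/
def relCycles : (n : ℕ) → AddSubgroup (RelChains A n)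
  | 0 => ⊤
  | n + 1 => (relBoundary A n).ker

/-- Relative `n`-boundaries. -/
def relBoundaries (n : ℕ) : AddSubgroup (RelChains A n) := (relBoundary A n).range

theorem relBoundaries_le_relCycles (n : ℕ) : relBoundaries A n ≤ relCycles A n := by
  cases n with
  | zero => exact le_top
  | succ n =>
    rintro _ ⟨c, rfl⟩
    exact relBoundary_relBoundary A c

/-- The relative homology `H_n(X, A)`: cycles modulo boundaries. -/
abbrev RelHomology (n : ℕ) : Type u :=
  relCycles A n ⧸ (relBoundaries A n).addSubgroupOf (relCycles A n)

end Relative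

/-! ## The fundamental groupoid on a set of base points and the Hurewicz morphism -/

section Hurewicz

variable {X : Type u} [TopologicalSpace X]

/-- The fundamental groupoid `π₁(X, A)`: its objects are the points of `A`, and its arrows are
the homotopy classes rel end points of paths in `X` between points of `A`. -/
abbrev FundGpd (A : Set X) : Type u :=
  InducedCategory (FundamentalGroupoid X) fun a : A => FundamentalGroupoid.mk (a : X)

/-- A path, regarded as a singular `1`-cube. -/
def pathCube {x y : X} (p : Path x y) : SingularCube X 1 where
  toFun t := p (t 0)

/-- The relative chain of a singular cube. -/
def relChain (A : Set X) {n : ℕ} (k : SingularCube X n) : RelChains A n :=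
  QuotientAddGroup.mk (QuotientAddGroup.mk (FreeAbelianGroup.of k))

theorem relChain_of_degenerate (A : Set X) {n : ℕ} (k : SingularCube X n) (hk : IsDegenerate k) :
    relChain A k = 0 := by
  have h : (QuotientAddGroup.mk (FreeAbelianGroup.of k) : Chains X n) = 0 :=
    (QuotientAddGroup.eq_zero_iff _).2 (AddSubgroup.subset_closure ⟨k, hk, rfl⟩)
  rw [relChain, h]
  rfl

theorem relChain_of_mem (A : Set X) {n : ℕ} (k : SingularCube X n) (hk : ∀ t, k t ∈ A) :
    relChain A k = 0 := by
  refine (QuotientAddGroup.eq_zero_iff _).2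
    ⟨QuotientAddGroup.mk (FreeAbelianGroup.of ⟨fun t => ⟨k t, hk t⟩, by fun_prop⟩), ?_⟩
  simp only [chainsMap, QuotientAddGroup.map_mk, FreeAbelianGroup.map_of_apply]
  rfl

theorem relBoundary_relChain (A : Set X) {n : ℕ} (k : SingularCube X (n + 1)) :
    relBoundary A n (relChain A k) = ∑ i : Fin (n + 1),
      (-1 : ℤ) ^ ((i : ℕ) + 1) • (relChain A (face i 0 k) - relChain A (face i 1 k)) := by
  have hq : ∀ x : FreeAbelianGroup (SingularCube X n),
      (QuotientAddGroup.mk (QuotientAddGroup.mk x) : RelChains A n) =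
        ((QuotientAddGroup.mk' (chainsMap (incl A) n).range).comp
          (QuotientAddGroup.mk' (degenerateChains X n))) x := fun _ => rfl
  simp only [relChain, relBoundary, boundary, QuotientAddGroup.map_mk, freeBoundary_of, hq,
    map_sum, map_zsmul, map_sub]

theorem pathCube_mem_relCycles (A : Set X) {a b : A} (p : Path (a : X) b) :
    relChain A (pathCube p) ∈ relCycles A 1 := by
  show relBoundary A 0 (relChain A (pathCube p)) = 0
  rw [relBoundary_relChain]
  refine Finset.sum_eq_zero fun i _ => ?_
  obtain rfl : i = 0 := Fin.fin_one_eq_zero i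
  rw [relChain_of_mem A (face 0 0 (pathCube p)), relChain_of_mem A (face 0 1 (pathCube p))]
  · simp
  · intro t
    simp [face, pathCube]
  · intro t
    simp [face, pathCube]

/-- The class in `H₁(X, A)` of a path in `X` between points of `A`. -/
def pathClass (A : Set X) {a b : A} (p : Path (a : X) b) : RelHomology A 1 :=
  QuotientAddGroup.mk ⟨relChain A (pathCube p), pathCube_mem_relCycles A p⟩

/-- A singular square whose sides `s = 0`, `s = 1`, `t = 0`, `t = 1` are `l`, `r`, `b`, `u`
yields the relative boundary `r - l - (u - b)`. -/
theorem square_mem_relBoundaries (A : Set X) (k : SingularCube X 2) :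
    (relChain A (face 0 1 k) - relChain A (face 0 0 k))
      - (relChain A (face 1 1 k) - relChain A (face 1 0 k)) ∈ relBoundaries A 1 := by
  refine ⟨relChain A k, ?_⟩
  rw [relBoundary_relChain]
  simp [Fin.sum_univ_two]
  abel

theorem insertNth_zero_apply_zero (e : I) (t : Fin 1 → I) :
    (Fin.insertNth (α := fun _ => I) (0 : Fin 2) e t) 0 = e := by simp

theorem insertNth_zero_apply_one (e : I) (t : Fin 1 → I) :
    (Fin.insertNth (α := fun _ => I) (0 : Fin 2) e t) 1 = t 0 :=
  Fin.insertNth_apply_succAbove (α := fun _ => I) (0 : Fin 2) e t 0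

theorem insertNth_one_apply_zero (e : I) (t : Fin 1 → I) :
    (Fin.insertNth (α := fun _ => I) (1 : Fin 2) e t) 0 = t 0 :=
  Fin.insertNth_apply_succAbove (α := fun _ => I) (1 : Fin 2) e t 0

theorem insertNth_one_apply_one (e : I) (t : Fin 1 → I) :
    (Fin.insertNth (α := fun _ => I) (1 : Fin 2) e t) 1 = e := by
  simp

theorem relChain_const (A : Set X) (k : SingularCube X 1) (h : ∀ s t, k s = k t) :
    relChain A k = 0 :=
  relChain_of_degenerate A k ⟨0, fun s t _ => h s t⟩

/-- Homotopic paths have the same class. -/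
theorem pathClass_homotopic (A : Set X) {a b : A} (p q : Path (a : X) b) (h : p.Homotopic q) :
    pathClass A p = pathClass A q := by
  obtain ⟨F⟩ := h
  let k : SingularCube X 2 := ⟨fun t => F (t 0, t 1), by fun_prop⟩
  have h00 : face 0 0 k = pathCube p := by
    ext t
    show F (_, _) = p (t 0)
    rw [insertNth_zero_apply_zero, insertNth_zero_apply_one]
    exact F.apply_zero _
  have h01 : face 0 1 k = pathCube q := by
    ext t
    show F (_, _) = q (t 0)
    rw [insertNth_zero_apply_zero, insertNth_zero_apply_one]
    exact F.apply_one _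
  have h10 : relChain A (face 1 0 k) = 0 := by
    have : ∀ t, face 1 0 k t = a := by
      intro t
      show F (_, _) = _
      rw [insertNth_one_apply_zero, insertNth_one_apply_one]
      exact F.source _
    exact relChain_const A _ fun s t => by rw [this, this]
  have h11 : relChain A (face 1 1 k) = 0 := by
    have : ∀ t, face 1 1 k t = b := by
      intro t
      show F (_, _) = _
      rw [insertNth_one_apply_zero, insertNth_one_apply_one]
      exact F.target _
    exact relChain_const A _ fun s t => by rw [this, this]
  have hk := square_mem_relBoundaries A k
  rw [h00, h01, h10, h11, sub_zero, sub_zero] at hk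
  refine QuotientAddGroup.eq.2 ?_
  rw [AddSubgroup.mem_addSubgroupOf]
  simpa [neg_add_eq_sub] using hk

/-- The class of a composite of paths is the sum of the classes. -/
theorem pathClass_trans (A : Set X) {a b c : A} (p : Path (a : X) b) (q : Path (b : X) c) :
    pathClass A (p.trans q) = pathClass A p + pathClass A q := by
  let φ : (Fin 2 → I) → ℝ := fun t => t 0 + (t 1 : ℝ) / 2 - (t 0 : ℝ) * t 1 / 2
  have hφ : Continuous φ := by fun_prop
  let k : SingularCube X 2 := ⟨fun t => (p.trans q).extend (φ t), by fun_prop⟩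
  have hval : ∀ t : Fin 2 → I, k t = (p.trans q).extend (φ t) := fun _ => rfl
  have h00 : face 0 0 k = pathCube p := by
    ext t
    show (p.trans q).extend (φ _) = p (t 0)
    have : φ (Fin.insertNth (α := fun _ => I) (0 : Fin 2) 0 t) = ((t 0 : ℝ) / 2) := by
      simp only [φ]
      rw [insertNth_zero_apply_zero, insertNth_zero_apply_one]
      simp
    rw [this]
    have h0 := (t 0).2.1
    have h1 := (t 0).2.2
    rw [Path.extend_apply _ ⟨by linarith, by linarith⟩, Path.trans_apply,
      dif_pos (show (t 0 : ℝ) / 2 ≤ 1 / 2 by linarith)]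
    congr 1
    ext
    show 2 * ((t 0 : ℝ) / 2) = t 0
    ring
  have h11 : face 1 1 k = pathCube q := by
    ext t
    show (p.trans q).extend (φ _) = q (t 0)
    have : φ (Fin.insertNth (α := fun _ => I) (1 : Fin 2) 1 t) = ((1 + (t 0 : ℝ)) / 2) := by
      simp only [φ]
      rw [insertNth_one_apply_zero, insertNth_one_apply_one]
      simp only [Set.Icc.coe_one]
      ring
    rw [this]
    have h0 := (t 0).2.1
    have h1 := (t 0).2.2
    rw [Path.extend_apply _ ⟨by linarith, by linarith⟩, Path.trans_apply]
    split_ifs with h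
    · have ht : (t 0) = 0 := by
        ext
        show (t 0 : ℝ) = 0
        have h' : (1 + (t 0 : ℝ)) / 2 ≤ 1 / 2 := h
        linarith
      refine Eq.trans ?_ ((congrArg q ht).trans q.source).symm
      refine Eq.trans (congrArg p (Subtype.ext ?_)) p.target
      show 2 * ((1 + (t 0 : ℝ)) / 2) = 1
      rw [ht]
      simp
    · congr 1
      ext
      show 2 * ((1 + (t 0 : ℝ)) / 2) - 1 = t 0
      ring
  have h10 : face 1 0 k = pathCube (p.trans q) := by
    ext t
    show (p.trans q).extend (φ _) = (p.trans q) (t 0)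
    have : φ (Fin.insertNth (α := fun _ => I) (1 : Fin 2) 0 t) = t 0 := by
      simp only [φ]
      rw [insertNth_one_apply_zero, insertNth_one_apply_one]
      simp
    rw [this, Path.extend_apply _ (t 0).2]
  have h01 : relChain A (face 0 1 k) = 0 := by
    have : ∀ t, face 0 1 k t = c := by
      intro t
      show (p.trans q).extend (φ _) = _
      have : φ (Fin.insertNth (α := fun _ => I) (0 : Fin 2) 1 t) = 1 := by
        simp only [φ]
        rw [insertNth_zero_apply_zero, insertNth_zero_apply_one]
        simp
      rw [this, Path.extend_one]
    exact relChain_const A _ fun s t => by rw [this, this]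
  have hk := square_mem_relBoundaries A k
  rw [h00, h01, h10, h11] at hk
  refine QuotientAddGroup.eq.2 ?_
  rw [AddSubgroup.mem_addSubgroupOf]
  show -relChain A (pathCube (p.trans q)) + (relChain A (pathCube p) + relChain A (pathCube q))
    ∈ relBoundaries A 1
  convert AddSubgroup.neg_mem _ hk using 1
  abel

/-- The Hurewicz morphism `π₁(X, A) → H₁(X, A)`, which sends the class of a path to the homology
class of that path. -/
def hurewicz (A : Set X) (a b : FundGpd A) (f : a ⟶ b) : RelHomology A 1 :=
  Quotient.lift (fun p : Path _ _ => pathClass A (a := a) (b := b) p)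
    (fun p q h => pathClass_homotopic A p q h) f.hom

theorem hurewicz_comp (A : Set X) (a b c : FundGpd A) (f : a ⟶ b) (g : b ⟶ c) :
    hurewicz A a c (f ≫ g) = hurewicz A a b f + hurewicz A b c g := by
  obtain ⟨f⟩ := f
  obtain ⟨g⟩ := g
  induction f using Quotient.inductionOn with | _ p =>
  induction g using Quotient.inductionOn with | _ q =>
  exact pathClass_trans A (a := a) (b := b) (c := c) p q

/-- The natural morphism `π₁(X, A)^totab → H₁(X, A)` induced by the Hurewicz morphism. -/
def hurewiczTotab (A : Set X) : Totab (FundGpd A) →+ RelHomology A 1 :=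
  totabLift (hurewicz A) (hurewicz_comp A)

/-- A space is totally path disconnected if distinct points are never joined by a path. -/
def TotallyPathDisconnected (Y : Type u) [TopologicalSpace Y] : Prop :=
  ∀ x y : Y, Joined x y → x = y

end Hurewicz

end RelHurewicz

end

/-! An inverse is built by moving end points into `A`. For each point x choose an arrow γ_x from x
to a point of `A`, trivial when x lies in `A`; this is possible because `A` meets every path
component. Send a 1-cube k from x to y to the class of γ_x⁻¹ k γ_y. Constant cubes go to 0, hence so
do cubes in `A`, which are constant by total path-disconnectedness. Boundaries go to 0 because the
two ways around a square are homotopic (`additive_square`). So there is a map θ from H₁ to the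
abelianisation.

Arrows between points of `A` keep their class (`totabClass_hom`), so θ is a left inverse of the
Hurewicz map. For the other composite, work in C₁/B₁, which contains H₁ and where paths with
arbitrary end points have additive, homotopy-invariant classes. There the image of k is [k] + [γ_y]
- [γ_x], that is, c goes to [c] + Γ(∂c) with Γ(x) = [γ_x] (`homologyIncl_chainsToTotab`). On cycles
the correction vanishes. -/

noncomputable section

namespace RelHurewicz

universe u v

/-! ### Maps out of relative chains. -/

section RelChainsLift

variable {X : Type u} [TopologicalSpace X] {A : Set X} {n : ℕ} {M : Type v} [AddCommGroup M]

/-- Additive maps out of relative chains, given on singular cubes. -/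
def relChainsLift (φ : SingularCube X n → M) (hdeg : ∀ k, IsDegenerate k → φ k = 0)
    (hA : ∀ k : SingularCube X n, (∀ t, k t ∈ A) → φ k = 0) : RelChains A n →+ M :=
  QuotientAddGroup.lift _
    (QuotientAddGroup.lift (degenerateChains X n) (FreeAbelianGroup.lift φ) (by
      rw [degenerateChains, AddSubgroup.closure_le]
      rintro _ ⟨k, hk, rfl⟩
      simp [AddMonoidHom.mem_ker, hdeg k hk])) (by
    rintro _ ⟨c, rfl⟩
    obtain ⟨c, rfl⟩ := QuotientAddGroup.mk_surjective c
    simp only [chainsMap, QuotientAddGroup.map_mk, QuotientAddGroup.lift_mk, AddMonoidHom.mem_ker]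
    induction c using FreeAbelianGroup.induction_on with
    | zero => simp
    | of k => simpa using hA _ fun t => (k t).2
    | neg k hk => simpa using hk
    | add x y hx hy => rw [map_add, map_add, hx, hy, add_zero])

@[simp]
theorem relChainsLift_relChain (φ : SingularCube X n → M) (hdeg : ∀ k, IsDegenerate k → φ k = 0)
    (hA : ∀ k : SingularCube X n, (∀ t, k t ∈ A) → φ k = 0) (k : SingularCube X n) :
    relChainsLift φ hdeg hA (relChain A k) = φ k := by
  simp [relChainsLift, relChain]

theorem relChains_hom_ext {α β : RelChains A n →+ M}
    (h : ∀ k, α (relChain A k) = β (relChain A k)) : α = β := by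
  apply QuotientAddGroup.addMonoidHom_ext
  apply QuotientAddGroup.addMonoidHom_ext
  apply FreeAbelianGroup.lift_ext
  exact h

end RelChainsLift

theorem toTotab_id {G : Type u} [Groupoid.{v} G] (a : G) : toTotab (𝟙 a) = 0 := by
  simpa using toTotab_comp (𝟙 a) (𝟙 a)

/-! ### Classes of arbitrary paths in C₁/B₁. -/

section ArrowClass

variable {X : Type u} [TopologicalSpace X] (A : Set X)

/-- The relative `1`-chains modulo boundaries. -/
def ChainsModBoundaries : Type u := RelChains A 1 ⧸ relBoundaries A 1

instance : AddCommGroup (ChainsModBoundaries A) :=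
  QuotientAddGroup.Quotient.addCommGroup (relBoundaries A 1)

/-- The projection to the relative `1`-chains modulo boundaries. -/
def modBoundaries : RelChains A 1 →+ ChainsModBoundaries A :=
  QuotientAddGroup.mk' (relBoundaries A 1)

theorem modBoundaries_eq_zero_iff (c : RelChains A 1) :
    modBoundaries A c = 0 ↔ c ∈ relBoundaries A 1 :=
  QuotientAddGroup.eq_zero_iff c

theorem modBoundaries_square (k : SingularCube X 2) :
    modBoundaries A (relChain A (face 0 1 k)) + modBoundaries A (relChain A (face 1 0 k))
      = modBoundaries A (relChain A (face 0 0 k)) + modBoundaries A (relChain A (face 1 1 k)) := by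
  have h := (modBoundaries_eq_zero_iff A _).2 (square_mem_relBoundaries A k)
  simp only [map_sub] at h
  rw [← sub_eq_zero, ← h]
  abel

/-- The class of a path in `X` in the relative chains modulo boundaries. -/
def chainClass {x y : X} (p : Path x y) : ChainsModBoundaries A :=
  modBoundaries A (relChain A (pathCube p))

/-- The homotopy is a square with two constant, hence degenerate, sides. Unlike in
`pathClass_homotopic`, the end points are arbitrary, as the paths γ_x require. -/
theorem chainClass_homotopic {x y : X} (p q : Path x y) (h : p.Homotopic q) :
    chainClass A p = chainClass A q := by
  obtain ⟨F⟩ := h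
  let k : SingularCube X 2 := ⟨fun t => F (t 0, t 1), by fun_prop⟩
  have h00 : face 0 0 k = pathCube p := by
    ext t
    show F (_, _) = p (t 0)
    rw [insertNth_zero_apply_zero, insertNth_zero_apply_one]
    exact F.apply_zero _
  have h01 : face 0 1 k = pathCube q := by
    ext t
    show F (_, _) = q (t 0)
    rw [insertNth_zero_apply_zero, insertNth_zero_apply_one]
    exact F.apply_one _
  have h10 : ∀ t, face 1 0 k t = x := by
    intro t
    show F (_, _) = _
    rw [insertNth_one_apply_zero, insertNth_one_apply_one]
    exact F.source _
  have h11 : ∀ t, face 1 1 k t = y := by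
    intro t
    show F (_, _) = _
    rw [insertNth_one_apply_zero, insertNth_one_apply_one]
    exact F.target _
  have hk := modBoundaries_square A k
  rw [h00, h01, relChain_const A (face 1 0 k) fun s t => by rw [h10, h10],
    relChain_const A (face 1 1 k) fun s t => by rw [h11, h11]] at hk
  rw [map_zero, add_zero, add_zero] at hk
  exact hk.symm

theorem chainClass_trans {x y z : X} (p : Path x y) (q : Path y z) :
    chainClass A (p.trans q) = chainClass A p + chainClass A q := by
  -- With coordinates (s, t) this is (1 - s) · t/2 + s · 1. Its sides are t/2 (giving `p`), (1 +
  -- s)/2 (giving `q`), s (giving the composite) and the constant 1.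
  let φ : (Fin 2 → I) → ℝ := fun t => t 0 + (t 1 : ℝ) / 2 - (t 0 : ℝ) * t 1 / 2
  have hφ : Continuous φ := by fun_prop
  let k : SingularCube X 2 := ⟨fun t => (p.trans q).extend (φ t), by fun_prop⟩
  have h00 : face 0 0 k = pathCube p := by
    ext t
    show (p.trans q).extend (φ _) = p (t 0)
    have : φ (Fin.insertNth (α := fun _ => I) (0 : Fin 2) 0 t) = ((t 0 : ℝ) / 2) := by
      simp only [φ]
      rw [insertNth_zero_apply_zero, insertNth_zero_apply_one]
      simp
    rw [this]
    have h0 := (t 0).2.1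
    have h1 := (t 0).2.2
    rw [Path.extend_apply _ ⟨by linarith, by linarith⟩, Path.trans_apply,
      dif_pos (show (t 0 : ℝ) / 2 ≤ 1 / 2 by linarith)]
    congr 1
    ext
    show 2 * ((t 0 : ℝ) / 2) = t 0
    ring
  have h11 : face 1 1 k = pathCube q := by
    ext t
    show (p.trans q).extend (φ _) = q (t 0)
    have : φ (Fin.insertNth (α := fun _ => I) (1 : Fin 2) 1 t) = ((1 + (t 0 : ℝ)) / 2) := by
      simp only [φ]
      rw [insertNth_one_apply_zero, insertNth_one_apply_one]
      simp only [Set.Icc.coe_one]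
      ring
    rw [this]
    have h0 := (t 0).2.1
    have h1 := (t 0).2.2
    rw [Path.extend_apply _ ⟨by linarith, by linarith⟩, Path.trans_apply]
    split_ifs with h
    -- The first half of the composite is met only at its midpoint, where both paths take the value
    -- `y`.
    · have ht : (t 0) = 0 := by
        ext
        show (t 0 : ℝ) = 0
        have h' : (1 + (t 0 : ℝ)) / 2 ≤ 1 / 2 := h
        linarith
      refine Eq.trans ?_ ((congrArg q ht).trans q.source).symm
      refine Eq.trans (congrArg p (Subtype.ext ?_)) p.target
      show 2 * ((1 + (t 0 : ℝ)) / 2) = 1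
      rw [ht]
      simp
    · congr 1
      ext
      show 2 * ((1 + (t 0 : ℝ)) / 2) - 1 = t 0
      ring
  have h10 : face 1 0 k = pathCube (p.trans q) := by
    ext t
    show (p.trans q).extend (φ _) = (p.trans q) (t 0)
    have : φ (Fin.insertNth (α := fun _ => I) (1 : Fin 2) 0 t) = t 0 := by
      simp only [φ]
      rw [insertNth_one_apply_zero, insertNth_one_apply_one]
      simp
    rw [this, Path.extend_apply _ (t 0).2]
  have h01 : ∀ t, face 0 1 k t = z := by
    intro t
    show (p.trans q).extend (φ _) = _
    have : φ (Fin.insertNth (α := fun _ => I) (0 : Fin 2) 1 t) = 1 := by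
      simp only [φ]
      rw [insertNth_zero_apply_zero, insertNth_zero_apply_one]
      simp
    rw [this, Path.extend_one]
  have hk := modBoundaries_square A k
  rw [h00, h11, h10, relChain_const A (face 0 1 k) fun s t => by rw [h01, h01],
    map_zero, zero_add] at hk
  exact hk

/-- The class of an arrow of the fundamental groupoid in the relative chains modulo boundaries. -/
def arrowClass {x y : FundamentalGroupoid X} (f : x ⟶ y) : ChainsModBoundaries A :=
  Quotient.lift (fun p : Path x.as y.as => chainClass A p)
    (fun p q h => chainClass_homotopic A p q h) f

theorem arrowClass_comp {x y z : FundamentalGroupoid X} (f : x ⟶ y) (g : y ⟶ z) :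
    arrowClass A (f ≫ g) = arrowClass A f + arrowClass A g := by
  induction f using Quotient.inductionOn with | _ p =>
  induction g using Quotient.inductionOn with | _ q =>
  exact chainClass_trans A p q

theorem arrowClass_id (x : FundamentalGroupoid X) : arrowClass A (𝟙 x) = 0 := by
  have h := arrowClass_comp A (𝟙 x) (𝟙 x)
  rwa [Category.comp_id, left_eq_add] at h

theorem arrowClass_inv {x y : FundamentalGroupoid X} (f : x ⟶ y) :
    arrowClass A (inv f) = -arrowClass A f := by
  rw [eq_neg_iff_add_eq_zero, ← arrowClass_comp, IsIso.inv_hom_id, arrowClass_id]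

/-- The inclusion of `H₁(X, A)` in the relative chains modulo boundaries. -/
def homologyIncl : RelHomology A 1 →+ ChainsModBoundaries A :=
  QuotientAddGroup.lift _ ((modBoundaries A).comp (relCycles A 1).subtype)
    fun c hc => (modBoundaries_eq_zero_iff A (c : RelChains A 1)).2 hc

theorem homologyIncl_injective : Function.Injective (homologyIncl A) := by
  rw [injective_iff_map_eq_zero]
  intro c hc
  obtain ⟨c, rfl⟩ := QuotientAddGroup.mk_surjective c
  exact (QuotientAddGroup.eq_zero_iff c).2 ((modBoundaries_eq_zero_iff A (c : RelChains A 1)).1 hc)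

theorem homologyIncl_hurewicz {a b : FundGpd A} (f : a ⟶ b) :
    homologyIncl A (hurewicz A a b f) = arrowClass A f.hom := by
  obtain ⟨f⟩ := f
  induction f using Quotient.inductionOn with | _ p => rfl

end ArrowClass

/-! ### Arrows of 1-cubes and the square relation. -/

section CubeArrow

variable {X : Type u} [TopologicalSpace X]

/-- A singular `1`-cube, regarded as a path. -/
def cubePath (k : SingularCube X 1) : Path (k fun _ => 0) (k fun _ => 1) where
  toFun t := k fun _ => t
  source' := rfl
  target' := rfl

theorem pathCube_cubePath (k : SingularCube X 1) : pathCube (cubePath k) = k := by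
  ext t
  exact congrArg k (funext fun i => by rw [Fin.fin_one_eq_zero i])

/-- The arrow of the fundamental groupoid of a singular `1`-cube. -/
def cubeArrow (k : SingularCube X 1) :
    FundamentalGroupoid.mk (k fun _ => 0) ⟶ FundamentalGroupoid.mk (k fun _ => 1) :=
  Path.Homotopic.Quotient.mk (cubePath k)

theorem arrowClass_cubeArrow (A : Set X) (k : SingularCube X 1) :
    arrowClass A (cubeArrow k) = modBoundaries A (relChain A k) :=
  congrArg (fun k => modBoundaries A (relChain A k)) (pathCube_cubePath k)

/-- An arrow of the fundamental groupoid is determined, up to equality of its end points, by the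
singular cube of a path which represents it. -/
theorem apply_cubeArrow {M : Type v} (ρ : ∀ x y : FundamentalGroupoid X, (x ⟶ y) → M)
    {x y : X} (p : Path x y) (k : SingularCube X 1) (h : ∀ t, k t = p (t 0)) :
    ρ _ _ (cubeArrow k) = ρ ⟨x⟩ ⟨y⟩ (Path.Homotopic.Quotient.mk p) := by
  obtain rfl : k = pathCube p := by
    ext t
    exact h t
  -- This replaces the end points by the values of `f` at 0 and 1, so both arrows have the same
  -- type.
  obtain ⟨f, rfl, rfl⟩ := p
  rfl

/-- Supplies the simple connectedness of `I × I` used in `additive_square`. -/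
instance : ContractibleSpace I :=
  (convex_Icc (0 : ℝ) 1).contractibleSpace ⟨0, by simp⟩

/-- An additive invariant of arrows of the fundamental groupoid agrees on the two ways around a
singular square. -/
theorem additive_square {M : Type v} [AddCommGroup M]
    (ρ : ∀ x y : FundamentalGroupoid X, (x ⟶ y) → M)
    (hρ : ∀ (x y z : FundamentalGroupoid X) (f : x ⟶ y) (g : y ⟶ z),
      ρ x z (f ≫ g) = ρ x y f + ρ y z g)
    (k : SingularCube X 2) :
    ρ _ _ (cubeArrow (face 0 1 k)) + ρ _ _ (cubeArrow (face 1 0 k))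
      = ρ _ _ (cubeArrow (face 0 0 k)) + ρ _ _ (cubeArrow (face 1 1 k)) := by
  let ι : Path (0 : I) 1 := ⟨ContinuousMap.id I, rfl, rfl⟩
  have hι : ∀ t, ι t = t := fun _ => rfl
  let f : C(I × I, X) := ⟨fun t => k ![t.1, t.2], by fun_prop⟩
  have h01 := apply_cubeArrow ρ (((Path.refl (1 : I)).prod ι).map f.continuous) (face 0 1 k)
    fun t => congrArg k (by ext i; fin_cases i <;> simp [hι, insertNth_zero_apply_one])
  have h00 := apply_cubeArrow ρ (((Path.refl (0 : I)).prod ι).map f.continuous) (face 0 0 k)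
    fun t => congrArg k (by ext i; fin_cases i <;> simp [hι, insertNth_zero_apply_one])
  have h10 := apply_cubeArrow ρ ((ι.prod (Path.refl (0 : I))).map f.continuous) (face 1 0 k)
    fun t => congrArg k (by ext i; fin_cases i <;> simp [hι, insertNth_one_apply_zero])
  have h11 := apply_cubeArrow ρ ((ι.prod (Path.refl (1 : I))).map f.continuous) (face 1 1 k)
    fun t => congrArg k (by ext i; fin_cases i <;> simp [hι, insertNth_one_apply_zero])
  -- Both paths run from (0, 0) to (1, 1) along the edges of a simply connected square; the homotopy
  -- is then mapped to `X`.
  have hom : ((ι.prod (Path.refl (0 : I))).trans ((Path.refl (1 : I)).prod ι)).Homotopic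
      (((Path.refl (0 : I)).prod ι).trans (ι.prod (Path.refl (1 : I)))) :=
    SimplyConnectedSpace.paths_homotopic _ _
  have hom' := Path.Homotopic.map hom f
  rw [Path.map_trans, Path.map_trans] at hom'
  rw [h01, h00, h10, h11, ← hρ, add_comm, ← hρ]
  exact congrArg (ρ _ _) (Quotient.sound hom')

end CubeArrow

/-! ### The inverse of the Hurewicz morphism. -/

section Inverse

variable {X : Type u} [TopologicalSpace X] {A : Set X}

/-- The point of `X` of an object of `π₁(X, A)`. -/
abbrev point (a : FundGpd A) : X := Subtype.val (p := (· ∈ A)) a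

/-- The object of `π₁(X, A)` of a point of `A`. -/
abbrev ofMem (x : X) (hx : x ∈ A) : FundGpd A := Subtype.mk (p := (· ∈ A)) x hx

/-- A choice, for every point of `X`, of an arrow to a point of `A`, trivial on `A`. -/
structure ArrowsToBase (A : Set X) where
  base : X → FundGpd A
  arrow (x : X) : FundamentalGroupoid.mk x ⟶ FundamentalGroupoid.mk (point (base x))
  -- Vanishing in the abelianisation is all that is needed, and it avoids asking for an equality of
  -- the objects `base (point a)` and `a`.
  exists_hom (a : FundGpd A) : ∃ c : a ⟶ base (point a), c.hom = arrow (point a) ∧ toTotab c = 0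

theorem nonempty_arrowsToBase (hmeet : ∀ x : X, (A ∩ pathComponent x).Nonempty) :
    Nonempty (ArrowsToBase A) := by
  have h : ∀ x : X, ∃ (b : FundGpd A)
      (γ : FundamentalGroupoid.mk x ⟶ FundamentalGroupoid.mk (point b)),
      ∀ hx : x ∈ A, ∃ c : ofMem x hx ⟶ b, c.hom = γ ∧ toTotab c = 0 := by
    intro x
    by_cases hx : x ∈ A
    · exact ⟨ofMem x hx, 𝟙 _, fun _ => ⟨𝟙 _, rfl, toTotab_id _⟩⟩
    · obtain ⟨y, hy, ⟨p⟩⟩ := hmeet x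
      exact ⟨ofMem y hy, Path.Homotopic.Quotient.mk p, fun hx' => absurd hx' hx⟩
  choose base arrow h using h
  exact ⟨base, arrow, fun a => h (point a) (Subtype.property (p := (· ∈ A)) a)⟩

namespace ArrowsToBase

variable (γ : ArrowsToBase A)

/-- The arrow of `π₁(X, A)` obtained by moving the end points of an arrow to `A`. -/
def transport {x y : FundamentalGroupoid X} (f : x ⟶ y) : γ.base x.as ⟶ γ.base y.as :=
  ⟨inv (γ.arrow x.as) ≫ f ≫ γ.arrow y.as⟩

theorem transport_comp {x y z : FundamentalGroupoid X} (f : x ⟶ y) (g : y ⟶ z) :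
    γ.transport (f ≫ g) = γ.transport f ≫ γ.transport g := by
  apply InducedCategory.hom_ext
  simp [transport]

/-- The class in `π₁(X, A)^totab` of an arrow of the fundamental groupoid of `X`. -/
def totabClass (x y : FundamentalGroupoid X) (f : x ⟶ y) : Totab (FundGpd A) :=
  toTotab (γ.transport f)

theorem totabClass_comp (x y z : FundamentalGroupoid X) (f : x ⟶ y) (g : y ⟶ z) :
    γ.totabClass x z (f ≫ g) = γ.totabClass x y f + γ.totabClass y z g := by
  rw [totabClass, transport_comp, toTotab_comp]
  rfl

/-- Transport fits into a commutative square with the arrows chosen at `a` and `b`, and these vanish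
in the abelianisation. -/
theorem totabClass_hom {a b : FundGpd A} (f : a ⟶ b) :
    γ.totabClass _ _ f.hom = toTotab f := by
  obtain ⟨c, hc, hc0⟩ := γ.exists_hom a
  obtain ⟨d, hd, hd0⟩ := γ.exists_hom b
  have h : c ≫ γ.transport f.hom = f ≫ d := by
    apply InducedCategory.hom_ext
    simp [transport, hc, hd]
  have h' := congrArg toTotab h
  rwa [toTotab_comp, toTotab_comp, hc0, hd0, zero_add, add_zero] at h'

/-- The arrow lifts to π₁(X, A) with zero class in the abelianisation, through which the Hurewicz
map factors. This makes `pointsToChains` well defined on relative chains. -/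
theorem arrowClass_arrow (a : FundGpd A) : arrowClass A (γ.arrow (point a)) = 0 := by
  obtain ⟨c, hc, hc0⟩ := γ.exists_hom a
  have h := congrArg (homologyIncl A) (totabLift_toTotab (hurewicz A) (hurewicz_comp A) c)
  rw [hc0, map_zero, map_zero, homologyIncl_hurewicz, hc] at h
  exact h.symm

theorem homologyIncl_totabClass {x y : FundamentalGroupoid X} (f : x ⟶ y) :
    homologyIncl A (hurewiczTotab A (γ.totabClass x y f))
      = arrowClass A f + (arrowClass A (γ.arrow y.as) - arrowClass A (γ.arrow x.as)) := by
  rw [totabClass, hurewiczTotab, totabLift_toTotab, homologyIncl_hurewicz]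
  refine (arrowClass_comp A _ _).trans ?_
  rw [arrowClass_inv, arrowClass_comp]
  abel

/-- A constant cube represents an identity, and additivity forces an idempotent to have class 0. -/
theorem totabClass_cubeArrow_of_const (k : SingularCube X 1) (hk : ∀ s t, k s = k t) :
    γ.totabClass _ _ (cubeArrow k) = 0 := by
  rw [apply_cubeArrow γ.totabClass (Path.refl (k fun _ => 0)) k fun t => hk _ _]
  have h := γ.totabClass_comp _ _ _ (𝟙 (FundamentalGroupoid.mk (k fun _ => 0))) (𝟙 _)
  rw [Category.comp_id, left_eq_add] at h
  exact h

/-- The cube is path connected, so its image in `A` is a single point. The disconnectedness of `A`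
enters the proof only here. -/
theorem eq_of_forall_mem (hA : TotallyPathDisconnected A) (k : SingularCube X 1)
    (hk : ∀ t, k t ∈ A) (s t : Fin 1 → I) : k s = k t := by
  let k' : C(Fin 1 → I, A) := ⟨fun t => ⟨k t, hk t⟩, by fun_prop⟩
  have hJ : Joined s t :=
    ⟨Path.pi fun i => PathConnectedSpace.somePath (s i) (t i)⟩
  exact congrArg Subtype.val (hA _ _ (hJ.map k'.continuous))

/-- The map `C₁(X, A) → π₁(X, A)^totab` which moves the end points of the cubes to `A`. -/
def chainsToTotab (hA : TotallyPathDisconnected A) : RelChains A 1 →+ Totab (FundGpd A) :=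
  relChainsLift (fun k => γ.totabClass _ _ (cubeArrow k))
    (by
      rintro k ⟨i, hi⟩
      refine γ.totabClass_cubeArrow_of_const k fun s t => hi s t fun j hj => ?_
      exact absurd (Subsingleton.elim j i) hj)
    fun k hk => γ.totabClass_cubeArrow_of_const k (eq_of_forall_mem hA k hk)

@[simp]
theorem chainsToTotab_relChain (hA : TotallyPathDisconnected A) (k : SingularCube X 1) :
    γ.chainsToTotab hA (relChain A k) = γ.totabClass _ _ (cubeArrow k) :=
  relChainsLift_relChain _ _ _ _

theorem chainsToTotab_relBoundary (hA : TotallyPathDisconnected A) (c : RelChains A 2) :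
    γ.chainsToTotab hA (relBoundary A 1 c) = 0 := by
  suffices h : (γ.chainsToTotab hA).comp (relBoundary A 1) = 0 from DFunLike.congr_fun h c
  apply relChains_hom_ext
  intro k
  have h := additive_square γ.totabClass γ.totabClass_comp k
  simp only [AddMonoidHom.comp_apply, relBoundary_relChain, map_sum, map_zsmul, map_sub,
    chainsToTotab_relChain, AddMonoidHom.zero_apply]
  rw [← sub_eq_zero] at h
  rw [← h]
  simp
  abel

/-- The inverse `H₁(X, A) → π₁(X, A)^totab` of the Hurewicz morphism. -/
def homologyToTotab (hA : TotallyPathDisconnected A) : RelHomology A 1 →+ Totab (FundGpd A) :=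
  QuotientAddGroup.lift _ ((γ.chainsToTotab hA).comp (relCycles A 1).subtype) (by
    rintro c ⟨d, hd⟩
    exact (congrArg (γ.chainsToTotab hA) hd).symm.trans (γ.chainsToTotab_relBoundary hA d))

theorem homologyToTotab_hurewiczTotab (hA : TotallyPathDisconnected A) (x : Totab (FundGpd A)) :
    γ.homologyToTotab hA (hurewiczTotab A x) = x := by
  suffices h : (γ.homologyToTotab hA).comp (hurewiczTotab A) = AddMonoidHom.id _ from
    DFunLike.congr_fun h x
  apply totab_hom_ext
  intro a b f
  rw [AddMonoidHom.comp_apply, hurewiczTotab, totabLift_toTotab, AddMonoidHom.id_apply,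
    ← γ.totabClass_hom f]
  obtain ⟨f⟩ := f
  induction f using Quotient.inductionOn with | _ p =>
  refine Eq.trans ?_ (apply_cubeArrow γ.totabClass p (pathCube p) fun _ => rfl)
  exact γ.chainsToTotab_relChain hA _

/-- The map `C₀(X, A) → C₁(X, A) / B₁(X, A)` given by the chosen arrows. -/
def pointsToChains : RelChains A 0 →+ ChainsModBoundaries A :=
  relChainsLift (fun k => arrowClass A (γ.arrow (k default)))
    (fun _ ⟨i, _⟩ => i.elim0) fun k hk => γ.arrowClass_arrow (ofMem (k default) (hk _))

/-- On a 1-cube from x to y the boundary is y - x, so the correction is [γ_y] - [γ_x]: the chosen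
arrows act as a chain homotopy. -/
theorem homologyIncl_chainsToTotab (hA : TotallyPathDisconnected A) (c : RelChains A 1) :
    homologyIncl A (hurewiczTotab A (γ.chainsToTotab hA c))
      = modBoundaries A c + γ.pointsToChains (relBoundary A 0 c) := by
  suffices h : ((homologyIncl A).comp (hurewiczTotab A)).comp (γ.chainsToTotab hA)
      = modBoundaries A + γ.pointsToChains.comp (relBoundary A 0) from
    DFunLike.congr_fun h c
  apply relChains_hom_ext
  intro k
  have hface : ∀ e : I, arrowClass A (γ.arrow (face 0 e k default))
      = arrowClass A (γ.arrow (k fun _ => e)) := fun e => by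
    have h : face 0 e k default = k fun _ => e :=
      congrArg k (funext fun i => by
        rw [Fin.fin_one_eq_zero i]
        exact Fin.insertNth_apply_same (α := fun _ => I) _ _ _)
    rw [h]
  simp only [AddMonoidHom.comp_apply, AddMonoidHom.add_apply, relBoundary_relChain,
    chainsToTotab_relChain, homologyIncl_totabClass, arrowClass_cubeArrow, pointsToChains]
  simp [hface]

/-- H₁ embeds in C₁/B₁, where the correction term depends only on the boundary of `c`, and this is
zero. -/
theorem hurewiczTotab_homologyToTotab (hA : TotallyPathDisconnected A) (c : RelHomology A 1) :
    hurewiczTotab A (γ.homologyToTotab hA c) = c := by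
  apply homologyIncl_injective A
  obtain ⟨c, rfl⟩ := QuotientAddGroup.mk_surjective c
  have hc : relBoundary A 0 c = 0 := c.2
  refine (γ.homologyIncl_chainsToTotab hA c).trans ?_
  rw [hc, map_zero, add_zero]
  rfl

end ArrowsToBase

end Inverse

end RelHurewicz

end

/-- Relative Hurewicz theorem in dimension `1`. -/
theorem mainTheorem1 {X : Type*} [TopologicalSpace X] (A : Set X)
    (hA : RelHurewicz.TotallyPathDisconnected A)
    (hmeet : ∀ x : X, (A ∩ pathComponent x).Nonempty) :
    Function.Bijective (RelHurewicz.hurewiczTotab A) := by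
  obtain ⟨γ⟩ := RelHurewicz.nonempty_arrowsToBase hmeet
  exact Function.bijective_iff_has_inverse.2 ⟨γ.homologyToTotab hA,
    γ.homologyToTotab_hurewiczTotab hA, γ.hurewiczTotab_homologyToTotab hA⟩
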